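/- Let $d\ge 3$ and let $\Gamma$ be a group with identity $e$ and a finite symmetric generating set $\mathcal S$, $|\mathcal S|=d$, such that the Cayley graph of $(\Gamma,\mathcal S)$ (with an edge between $x$ and $y$ iff $yx^{-1}\in\mathcal S$) is the infinite $d$-regular tree. Let $p\in[0,1)$. The elephant random walk on $\Gamma$ with memory parameter $p$ has steps $g_1,g_2,\ldots\in\mathcal S$ defined as follows: $g_1$ is uniform on $\mathcal S$; for $n\ge 1$, given $g_1,\ldots,g_n$, choose $D$ uniformly from $\{1,\ldots,n\}$, and let $g_{n+1}=g_D$ with probability $p$ and $g_{n+1}=a$ with probability $\frac{1-p}{d-1}$ for each $a\in\mathcal S\setminus\{g_D\}$. Let $w_0=e$, $w_n=g_n\cdots g_1$, and let $\Delta_n=\rho(w_n,e)$, where $\rho$ is the word metric with respect to $\mathcal S$ (the graph distance in the Cayley graph). Put \[ \alpha_{p,d}=\begin{cases}1-\frac{2(1-p)}{d-1} & \text{if } 0\le p\le 1/d,\\ 1-2p & \text{if } 1/d<p<1/2.\end{cases} \] (1) If $0\le p<1/2$ and $(p,d)\ne(0,3)$, then for all $n\ge 0$ \[ \mathbb P(\Delta_n=0)\le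 \exp\left(-\frac{n\,\alpha_{p,d}^2}{8}\right). \] (2) If $p\in[1/2,1)$ or $(p,d)=(0,3)$, then there is a constant $C>0$, depending only on $p$ and $d$, such that $\mathbb P(\Delta_n=0)\le C\,n^{-1}$ for all $n\ge 1$. -/

import Mathlib

open MeasureTheory

universe u v

namespace ElephantWalk

/-- The left Cayley graph of a group `Γ` with respect to a finite set `S`: distinct `x, y` are
joined by an edge iff `y * x⁻¹ ∈ S` (for symmetric `S` this relation is symmetric). -/
def cayleyGraph {Γ : Type u} [Group Γ] (S : Finset Γ) : SimpleGraph Γ :=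
  SimpleGraph.fromRel fun x y => y * x⁻¹ ∈ S

/-- `S` is a symmetric generating set of `Γ` with `d` elements whose Cayley graph is the
`d`-regular tree. Since `1 ∉ S`, every vertex `x` has exactly the `d` distinct neighbours `a * x`,
`a ∈ S`, so the tree is automatically `d`-regular. -/
structure IsTreeGeneratingSet {Γ : Type u} [Group Γ] (S : Finset Γ) (d : ℕ) : Prop where
  card_eq : S.card = d
  one_notMem : (1 : Γ) ∉ S
  inv_mem : ∀ a ∈ S, a⁻¹ ∈ S
  generates : Subgroup.closure (S : Set Γ) = ⊤
  isTree : (cayleyGraph S).IsTree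

/-- The word metric of `Γ` with respect to `S`, that is, the graph distance in the Cayley graph. -/
noncomputable def wordDist {Γ : Type u} [Group Γ] (S : Finset Γ) (x y : Γ) : ℕ :=
  (cayleyGraph S).dist x y

/-- The probability that the next step is `a` when the recalled step is `b`: the recalled step is
repeated with probability `p`, and each other element of `S` has probability
`(1 - p) / (|S| - 1)`. -/
noncomputable def stepProb {Γ : Type u} (S : Finset Γ) (p : ℝ) (b a : S) : ℝ :=
  open Classical in if a = b then p else (1 - p) / ((S.card : ℝ) - 1)

/-- `g` is the sequence of steps of an elephant random walk with step set `S` and memory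
parameter `p`, on the probability space `(Ω, P)`. Time is counted from `0`: `g n` is the
`(n + 1)`-st step, and `D n` is the (uniformly chosen) index of the earlier step, among
`g 0, …, g n`, which is recalled to produce `g (n + 1)`. -/
structure IsElephantSteps {Γ : Type u} {Ω : Type v} [MeasurableSpace Ω] (P : Measure Ω)
    (S : Finset Γ) (p : ℝ) (g : ℕ → Ω → S) (D : (n : ℕ) → Ω → Fin (n + 1)) : Prop where
  measurableSet_step : ∀ (n : ℕ) (a : S), MeasurableSet {ω | g n ω = a}
  measurableSet_recall : ∀ (n : ℕ) (j : Fin (n + 1)), MeasurableSet {ω | D n ω = j}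
  /-- The first step is uniform on `S`. -/
  first_step : ∀ a : S, P.real {ω | g 0 ω = a} = 1 / (S.card : ℝ)
  /-- Given the past steps `g 0 = s 0, …, g n = s n`, the index `D n` is uniform on the past,
  and, given moreover `D n = j`, the next step has distribution `stepProb S p (s j)`. -/
  next_step : ∀ (n : ℕ) (s : Fin (n + 1) → S) (j : Fin (n + 1)) (a : S),
    P.real {ω | (∀ i : Fin (n + 1), g i ω = s i) ∧ D n ω = j ∧ g (n + 1) ω = a} =
      P.real {ω | ∀ i : Fin (n + 1), g i ω = s i} * (1 / ((n : ℝ) + 1)) * stepProb S p (s j) a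

/-- The position of the walk after `n` steps: the group element
`x (n - 1) * ⋯ * x 1 * x 0`. -/
def position {Γ : Type u} [Group Γ] {S : Finset Γ} (x : ℕ → S) : ℕ → Γ
  | 0 => 1
  | n + 1 => (x n : Γ) * position x n

/-- `Δ_n`: the distance of the walk from the root `1` after `n` steps. -/
noncomputable def distRoot {Γ : Type u} [Group Γ] {Ω : Type v} {S : Finset Γ}
    (g : ℕ → Ω → S) (n : ℕ) (ω : Ω) : ℕ :=
  wordDist S (position (fun k => g k ω) n) 1

/-- The exponent `α_{p,d}`, meant for `0 ≤ p < 1/2`. -/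
noncomputable def alpha (p : ℝ) (d : ℕ) : ℝ :=
  if p ≤ 1 / (d : ℝ) then 1 - 2 * (1 - p) / ((d : ℝ) - 1) else 1 - 2 * p

end ElephantWalk

/-! In a tree only one neighbour of a vertex can be closer to the root. So if, given the history,
every step has probability at most `q < 1/2`, then the expectation of `r ^ Δ`, for suitable `r < 1`,
shrinks by the factor `q / r + (1 - q) * r < 1` (`avgStep_pow_height_le`); and it dominates the
probability of `Δ = 0`.

The next step is `a` with probability `1/d + θ * (frequency of a - 1/d)`, where `θ = (p d - 1)/(d -
1)`. In (1) this never exceeds `(1 - α)/2 < 1/2`, so the contraction is uniform.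

In (2) it can reach `1/2` or more, but rarely: the excess of `a` is sub-Gaussian with a variance
proxy of order at most `m ^ γ`, `γ < 2`, because `θ < 1` (`exists_varianceProxy_le`). Deviations of
order `m` thus have stretched-exponentially small probability, and the contraction fails only with
probability `O(1/m)`, which gives the `1/n` bound (`mul_expect_pow_height_le`).

The probability space enters only through `IsElephantSteps.sum_measureReal_le_expect`; all else
concerns an operator on histories. -/

namespace ElephantWalk

/-! ### Transition operator on histories and contraction of the height -/

section Operator

variable {α : Type*} [Fintype α] [DecidableEq α]

/-- The excess of the number of occurrences of `a` in the history `l` over its fair share. -/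
noncomputable def excess (l : List α) (a : α) : ℝ :=
  (l.count a : ℝ) - (l.length : ℝ) / (Fintype.card α : ℝ)

/-- The conditional probability of the next step `a` given the history `l`, for the
reinforcement parameter `θ`. -/
noncomputable def stepWeight (θ : ℝ) (l : List α) (a : α) : ℝ :=
  1 / (Fintype.card α : ℝ) + θ * (excess l a / (l.length : ℝ))

/-- The one-step transition operator on functions of the history. -/
noncomputable def avgStep (θ : ℝ) (f : List α → ℝ) (l : List α) : ℝ :=
  ∑ a, stepWeight θ l a * f (a :: l)

/-- The expectation of `f` evaluated at the history of length `n`. -/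
noncomputable def expect (θ : ℝ) : ℕ → (List α → ℝ) → ℝ
  | 0, f => f []
  | n + 1, f => expect θ n (avgStep θ f)

lemma excess_nil (a : α) : excess [] a = 0 := by simp [excess]

lemma excess_cons (l : List α) (a b : α) :
    excess (b :: l) a = excess l a + ((if b = a then 1 else 0) - 1 / (Fintype.card α : ℝ)) := by
  simp only [excess, List.count_cons, List.length_cons, beq_iff_eq]
  push_cast
  ring

lemma sum_excess [Nonempty α] (l : List α) : ∑ a, excess l a = 0 := by
  have hd : (Fintype.card α : ℝ) ≠ 0 := by simp
  induction l with
  | nil => simp [excess_nil]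
  | cons b l ih =>
    simp only [excess_cons, Finset.sum_add_distrib, ih, Finset.sum_sub_distrib]
    simp [hd]

lemma sum_stepWeight [Nonempty α] (θ : ℝ) (l : List α) : ∑ a, stepWeight θ l a = 1 := by
  have hd : (Fintype.card α : ℝ) ≠ 0 := by simp
  simp only [stepWeight, Finset.sum_add_distrib, ← Finset.mul_sum, ← Finset.sum_div, sum_excess]
  simp [hd]

lemma excess_div_length_le [Nonempty α] (l : List α) (a : α) :
    excess l a / (l.length : ℝ) ≤ 1 - 1 / (Fintype.card α : ℝ) := by
  have hd : (1 : ℝ) ≤ Fintype.card α := by exact_mod_cast Fintype.card_pos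
  rcases Nat.eq_zero_or_pos l.length with h | h
  · simp only [h, Nat.cast_zero, div_zero, sub_nonneg]
    exact div_le_one_of_le₀ hd (by positivity)
  · have h' : (0 : ℝ) < l.length := by exact_mod_cast h
    have hc : (l.count a : ℝ) ≤ l.length := by exact_mod_cast List.count_le_length
    rw [div_le_iff₀ h', excess]
    have : (1 - 1 / (Fintype.card α : ℝ)) * l.length = l.length - l.length / Fintype.card α := by
      ring
    linarith

lemma le_excess_div_length [Nonempty α] (l : List α) (a : α) :
    -(1 / (Fintype.card α : ℝ)) ≤ excess l a / (l.length : ℝ) := by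
  rcases Nat.eq_zero_or_pos l.length with h | h
  · simp [h]
  · have h' : (0 : ℝ) < l.length := by exact_mod_cast h
    have hc : (0 : ℝ) ≤ l.count a := by positivity
    rw [le_div_iff₀ h', excess]
    have : -(1 / (Fintype.card α : ℝ)) * l.length = - (l.length / Fintype.card α) := by
      ring
    linarith

lemma stepWeight_nonneg [Nonempty α] {θ : ℝ} (h0 : 0 ≤ 1 + θ * ((Fintype.card α : ℝ) - 1))
    (h1 : θ ≤ 1) (l : List α) (a : α) : 0 ≤ stepWeight θ l a := by
  have hd : (0 : ℝ) < Fintype.card α := by exact_mod_cast Fintype.card_pos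
  have hu := excess_div_length_le l a
  have hl := le_excess_div_length l a
  rw [stepWeight]
  rcases le_total 0 θ with h | h
  · have h2 := mul_le_mul_of_nonneg_left hl h
    have h3 := mul_le_mul_of_nonneg_right h1 (by positivity : 0 ≤ 1 / (Fintype.card α : ℝ))
    linarith
  · have h2 := mul_le_mul_of_nonpos_left hu h
    have h3 : 0 ≤ (1 + θ * ((Fintype.card α : ℝ) - 1)) / Fintype.card α := by positivity
    have h4 : (1 + θ * ((Fintype.card α : ℝ) - 1)) / Fintype.card α =
        1 / Fintype.card α + θ * (1 - 1 / (Fintype.card α : ℝ)) := by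
      field_simp
    linarith

lemma stepWeight_le_one [Nonempty α] {θ : ℝ} (h0 : 0 ≤ 1 + θ * ((Fintype.card α : ℝ) - 1))
    (h1 : θ ≤ 1) (l : List α) (a : α) : stepWeight θ l a ≤ 1 := by
  rw [← sum_stepWeight θ l]
  exact Finset.single_le_sum (f := stepWeight θ l) (fun b _ => stepWeight_nonneg h0 h1 l b)
    (Finset.mem_univ a)

lemma expect_mono {θ : ℝ} (hw : ∀ (l : List α) a, 0 ≤ stepWeight θ l a) {n : ℕ}
    {f g : List α → ℝ} (h : ∀ l, l.length = n → f l ≤ g l) : expect θ n f ≤ expect θ n g := by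
  induction n generalizing f g with
  | zero => exact h [] rfl
  | succ n ih =>
    refine ih fun l hl => Finset.sum_le_sum fun a _ => ?_
    exact mul_le_mul_of_nonneg_left (h _ (by simp [hl])) (hw l a)

lemma expect_add (θ : ℝ) (n : ℕ) (f g : List α → ℝ) :
    expect θ n (fun l => f l + g l) = expect θ n f + expect θ n g := by
  induction n generalizing f g with
  | zero => rfl
  | succ n ih =>
    simp only [expect, ← ih]
    congr 1
    ext l
    simp [avgStep, mul_add, Finset.sum_add_distrib]

lemma expect_const_mul (θ : ℝ) (n : ℕ) (c : ℝ) (f : List α → ℝ) :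
    expect θ n (fun l => c * f l) = c * expect θ n f := by
  induction n generalizing f with
  | zero => rfl
  | succ n ih =>
    simp only [expect, ← ih]
    congr 1
    ext l
    simp only [avgStep, Finset.mul_sum]
    exact Finset.sum_congr rfl fun a _ => by ring

lemma expect_const [Nonempty α] (θ : ℝ) (n : ℕ) (c : ℝ) :
    expect θ n (fun _ : List α => c) = c := by
  induction n with
  | zero => rfl
  | succ n ih =>
    have : avgStep θ (fun _ : List α => c) = fun _ => c := by
      ext l
      simp [avgStep, ← Finset.sum_mul, sum_stepWeight]
    rw [expect, this, ih]

lemma expect_sum {ι : Type*} (θ : ℝ) (n : ℕ) (s : Finset ι) (f : ι → List α → ℝ) :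
    expect θ n (fun l => ∑ i ∈ s, f i l) = ∑ i ∈ s, expect θ n (f i) := by
  classical
  induction s using Finset.induction_on with
  | empty => simpa using expect_const_mul θ n 0 (fun _ : List α => (0 : ℝ))
  | insert i s hi ih => simp only [Finset.sum_insert hi, expect_add, ih]

/-- The height `Δ` of a history grows by one at each step, except for a single step value, for
which it drops by at most one. -/
def IsTreeHeight (Δ : List α → ℕ) : Prop :=
  ∀ l, ∃ b, (∀ a, a ≠ b → Δ (a :: l) = Δ l + 1) ∧ Δ l ≤ Δ (b :: l) + 1

/-- Since `1 / r ≥ r`, the bound increases with the weight of the exceptional step `b`, so that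
weight may be replaced by `q`. -/
lemma avgStep_pow_height_le [Nonempty α] {θ : ℝ} (hw : ∀ (l : List α) a, 0 ≤ stepWeight θ l a)
    {Δ : List α → ℕ} (hΔ : IsTreeHeight Δ) {r q : ℝ} (hr : 0 < r) (hr1 : r ≤ 1) {l : List α}
    (hq : ∀ a, stepWeight θ l a ≤ q) :
    avgStep θ (fun l => r ^ Δ l) l ≤ (q / r + (1 - q) * r) * r ^ Δ l := by
  obtain ⟨b, hb, hb'⟩ := hΔ l
  have hpow : r ^ Δ (b :: l) ≤ r ^ Δ l / r := by
    rw [le_div_iff₀ hr, ← pow_succ]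
    exact pow_le_pow_of_le_one hr.le hr1 hb'
  have hsum : ∑ a ∈ Finset.univ.erase b, stepWeight θ l a * r ^ Δ (a :: l) =
      (1 - stepWeight θ l b) * (r ^ Δ l * r) := by
    rw [← sum_stepWeight θ l, ← Finset.add_sum_erase _ _ (Finset.mem_univ b), add_sub_cancel_left,
      Finset.sum_mul]
    refine Finset.sum_congr rfl fun a ha => ?_
    rw [hb a (Finset.ne_of_mem_erase ha), pow_succ]
  rw [avgStep, ← Finset.add_sum_erase _ _ (Finset.mem_univ b), hsum]
  have h1 := mul_le_mul_of_nonneg_left hpow (hw l b)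
  have hrr : 0 ≤ 1 / r - r := by
    have : 1 ≤ 1 / r := one_le_one_div hr hr1
    linarith
  have h2 : 0 ≤ (q - stepWeight θ l b) * (1 / r - r) * r ^ Δ l :=
    mul_nonneg (mul_nonneg (sub_nonneg.2 (hq b)) hrr) (by positivity)
  calc _ ≤ stepWeight θ l b * (r ^ Δ l / r) + (1 - stepWeight θ l b) * (r ^ Δ l * r) := by linarith
    _ = (q / r + (1 - q) * r) * r ^ Δ l - (q - stepWeight θ l b) * (1 / r - r) * r ^ Δ l := by
      ring
    _ ≤ _ := by linarith

lemma expect_pow_height_le [Nonempty α] {θ : ℝ} (hw : ∀ (l : List α) a, 0 ≤ stepWeight θ l a)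
    {Δ : List α → ℕ} (hΔ : IsTreeHeight Δ) {r q : ℝ} (hr : 0 < r) (hr1 : r ≤ 1)
    (hκ : 0 ≤ q / r + (1 - q) * r)
    (hq : ∀ (l : List α) a, stepWeight θ l a ≤ q) (n : ℕ) :
    expect θ n (fun l => r ^ Δ l) ≤ (q / r + (1 - q) * r) ^ n := by
  induction n with
  | zero => simpa [expect] using pow_le_one₀ hr.le hr1
  | succ n ih =>
    rw [expect, pow_succ']
    refine (expect_mono hw fun l _ => avgStep_pow_height_le hw hΔ hr hr1 (hq l)).trans ?_
    rw [expect_const_mul]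
    exact mul_le_mul_of_nonneg_left ih hκ

end Operator

/-! ### Sub-Gaussian estimates and growth of the variance proxy -/

/-- For `|t| ≤ 1`, average `exp x ≤ 1 + x + t ^ 2`: the linear terms cancel. For `|t| ≥ 1` both
exponents are at most `|t| ≤ t ^ 2`. -/
lemma centered_exp_le {q t : ℝ} (h0 : 0 ≤ q) (h1 : q ≤ 1) :
    q * Real.exp (t * (1 - q)) + (1 - q) * Real.exp (-(t * q)) ≤ Real.exp (t ^ 2) := by
  have h1' : 0 ≤ 1 - q := by linarith
  rcases le_total |t| 1 with ht | ht
  · have ht2 : t ^ 2 ≤ 1 := (sq_le_one_iff_abs_le_one t).2 ht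
    have key : ∀ s : ℝ, 0 ≤ s → s ≤ 1 → ∀ x : ℝ, x ^ 2 = (t * s) ^ 2 →
        Real.exp x ≤ 1 + x + t ^ 2 := by
      intro s hs hs1 x hx
      have hs2 : x ^ 2 ≤ t ^ 2 := by
        rw [hx, mul_pow]
        exact mul_le_of_le_one_right (sq_nonneg t) (pow_le_one₀ hs hs1)
      have hx1 : |x| ≤ 1 := (sq_le_one_iff_abs_le_one x).1 (hs2.trans ht2)
      have := (abs_le.1 (Real.abs_exp_sub_one_sub_id_le hx1)).2
      linarith
    have e1 := mul_le_mul_of_nonneg_left (key (1 - q) h1' (by linarith) (t * (1 - q)) rfl) h0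
    have e2 := mul_le_mul_of_nonneg_left (key q h0 h1 (-(t * q)) (by ring)) h1'
    have e3 := Real.add_one_le_exp (t ^ 2)
    linarith
  · have htt : |t| ≤ t ^ 2 := by
      rw [← sq_abs]
      nlinarith
    have key : ∀ x : ℝ, x ≤ |t| → Real.exp x ≤ Real.exp (t ^ 2) := fun x hx =>
      Real.exp_le_exp.2 (hx.trans htt)
    have e1 := mul_le_mul_of_nonneg_left (key (t * (1 - q)) (by
      nlinarith [le_abs_self t, neg_abs_le t, abs_nonneg t])) h0
    have e2 := mul_le_mul_of_nonneg_left (key (-(t * q)) (by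
      nlinarith [le_abs_self t, neg_abs_le t, abs_nonneg t])) h1'
    linarith

/-- A variance proxy for the excess after `n` steps. -/
noncomputable def varianceProxy (θ : ℝ) : ℕ → ℝ
  | 0 => 0
  | n + 1 => (1 + θ / n) ^ 2 * varianceProxy θ n + 1

lemma varianceProxy_nonneg (θ : ℝ) (n : ℕ) : 0 ≤ varianceProxy θ n := by
  cases n with
  | zero => exact le_rfl
  | succ n =>
    induction n with
    | zero => simp [varianceProxy]
    | succ n ih => rw [varianceProxy]; positivity

/-- The recursion multiplies by about `1 + 2 τ / m`, while `m ^ (1 + τ)` grows by at least `1 + (1 +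
τ) / m`. As `τ < 1`, the difference absorbs the added `1` once `m` and `A` are large. -/
lemma exists_varianceProxy_le {θ : ℝ} (h0 : -1 ≤ θ) (h1 : θ < 1) :
    ∃ γ A : ℝ, 1 ≤ γ ∧ γ < 2 ∧ 0 < A ∧ ∃ M : ℕ, 1 ≤ M ∧
      ∀ m : ℕ, M ≤ m → varianceProxy θ m ≤ A * (m : ℝ) ^ γ := by
  -- The floor keeps the exponent `1 + τ` at least `1` when `θ` is negative.
  set τ := max θ (1 / 2) with hτ
  have hτ1 : τ < 1 := max_lt h1 (by norm_num)
  have hτ0 : 1 / 2 ≤ τ := le_max_right _ _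
  have hθτ : θ ≤ τ := le_max_left _ _
  -- Beyond this `M`, the quadratic term `τ ^ 2 / m` uses up at most half of the gap `1 - τ`.
  obtain ⟨M, hM⟩ := exists_nat_gt (2 * τ ^ 2 / (1 - τ))
  have hMpos : (0 : ℝ) < M := lt_of_le_of_lt (by have : 0 < 1 - τ := by linarith
                                                 positivity) hM
  have hM1 : 1 ≤ M := by exact_mod_cast hMpos
  set A := max (2 / (1 - τ)) (varianceProxy θ M) with hA
  have hA2 : 2 / (1 - τ) ≤ A := le_max_left _ _
  have hApos : 0 < A := lt_of_lt_of_le (div_pos two_pos (by linarith)) hA2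
  refine ⟨1 + τ, A, by linarith, by linarith, hApos, M, hM1, fun m hm => ?_⟩
  induction m, hm using Nat.le_induction with
  | base =>
    refine (le_max_right _ _ : varianceProxy θ M ≤ A).trans (le_mul_of_one_le_right hApos.le ?_)
    exact Real.one_le_rpow (by exact_mod_cast hM1) (by linarith)
  | succ m hm ih =>
    have hmM : (M : ℝ) ≤ m := by exact_mod_cast hm
    have hm1 : (1 : ℝ) ≤ m := by exact_mod_cast hM1.trans hm
    have hm0 : (0 : ℝ) < m := by linarith
    have hsq : (1 + θ / m) ^ 2 ≤ (1 + τ / m) ^ 2 := by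
      refine pow_le_pow_left₀ ?_ (by gcongr) 2
      have : -1 ≤ θ / m := by rw [le_div_iff₀ hm0]; linarith
      linarith
    have hpow : (m : ℝ) ≤ (m : ℝ) ^ (1 + τ) := by
      simpa using Real.rpow_le_rpow_of_exponent_le hm1 (by linarith : (1 : ℝ) ≤ 1 + τ)
    have hbern : (m : ℝ) ^ (1 + τ) * (1 + (1 + τ) / m) ≤ ((m + 1 : ℕ) : ℝ) ^ (1 + τ) := by
      have hb := one_add_mul_self_le_rpow_one_add (s := 1 / (m : ℝ)) (p := 1 + τ)
        (by have : 0 < 1 / (m : ℝ) := by positivity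
            linarith) (by linarith)
      have hmul : (((m + 1 : ℕ) : ℝ)) = m * (1 + 1 / m) := by
        push_cast
        field_simp
      rw [hmul, Real.mul_rpow hm0.le (by positivity)]
      refine mul_le_mul_of_nonneg_left ?_ (by positivity)
      calc _ = 1 + (1 + τ) * (1 / (m : ℝ)) := by ring
        _ ≤ _ := hb
    have hgain : 1 ≤ A * ((m : ℝ) ^ (1 + τ) / m) * ((1 - τ) - τ ^ 2 / m) := by
      have g1 : (1 - τ) / 2 ≤ (1 - τ) - τ ^ 2 / m := by
        have : τ ^ 2 / m ≤ (1 - τ) / 2 := by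
          rw [div_lt_iff₀ (by linarith)] at hM
          rw [div_le_iff₀ hm0]
          nlinarith
        linarith
      have g2 : 1 ≤ (m : ℝ) ^ (1 + τ) / m := by rwa [le_div_iff₀ hm0, one_mul]
      have g3 : 1 ≤ A * ((1 - τ) / 2) := by
        have := mul_le_mul_of_nonneg_right hA2 (by linarith : 0 ≤ (1 - τ) / 2)
        have h' : 2 / (1 - τ) * ((1 - τ) / 2) = 1 := by
          have : 1 - τ ≠ 0 := by linarith
          field_simp
        linarith
      calc (1 : ℝ) ≤ A * ((1 - τ) / 2) := g3
        _ ≤ A * ((m : ℝ) ^ (1 + τ) / m) * ((1 - τ) - τ ^ 2 / m) :=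
          mul_le_mul (le_mul_of_one_le_right hApos.le g2) g1 (by linarith) (by positivity)
    calc varianceProxy θ (m + 1) ≤ (1 + τ / m) ^ 2 * (A * (m : ℝ) ^ (1 + τ)) + 1 := by
          rw [varianceProxy]
          gcongr
          exact varianceProxy_nonneg θ m
      _ ≤ (1 + τ / m) ^ 2 * (A * (m : ℝ) ^ (1 + τ))
            + A * ((m : ℝ) ^ (1 + τ) / m) * ((1 - τ) - τ ^ 2 / m) := by gcongr
      _ = A * ((m : ℝ) ^ (1 + τ) * (1 + (1 + τ) / m)) := by field_simp; ring
      _ ≤ A * ((m + 1 : ℕ) : ℝ) ^ (1 + τ) := by gcongr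

lemma exists_mul_exp_neg_rpow_le {c σ : ℝ} (hc : 0 < c) (hσ : 0 < σ) :
    ∃ K : ℝ, ∀ m : ℕ, (m : ℝ) * Real.exp (-c * (m : ℝ) ^ σ) ≤ K := by
  have h1 : Filter.Tendsto (fun x : ℝ => x ^ (1 / σ) * Real.exp (-c * x)) Filter.atTop (nhds 0) :=
    tendsto_rpow_mul_exp_neg_mul_atTop_nhds_zero (1 / σ) c hc
  have h2 := h1.comp ((tendsto_rpow_atTop hσ).comp tendsto_natCast_atTop_atTop)
  obtain ⟨K, hK⟩ := h2.bddAbove_range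
  refine ⟨K, fun m => ?_⟩
  have := hK ⟨m, rfl⟩
  simp only [Function.comp_apply] at this
  rwa [← Real.rpow_mul (Nat.cast_nonneg m), mul_one_div_cancel hσ.ne', Real.rpow_one] at this

lemma exists_deviation_bound {θ : ℝ} (h0 : -1 ≤ θ) (h1 : θ < 1) {ε : ℝ} (hε : 0 < ε) :
    ∃ K : ℝ, 0 ≤ K ∧ ∀ m : ℕ, ∃ t : ℝ, 0 ≤ t ∧
      ((m : ℝ) + 1) * Real.exp (t ^ 2 * varianceProxy θ m - t * (ε * m)) ≤ K := by
  obtain ⟨γ, A, hγ1, hγ2, hA, M, hM, hv⟩ := exists_varianceProxy_le h0 h1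
  obtain ⟨K, hK⟩ := exists_mul_exp_neg_rpow_le (c := ε ^ 2 / (4 * A)) (σ := 2 - γ)
    (by positivity) (by linarith)
  refine ⟨max (M : ℝ) (2 * K), le_max_of_le_left (by positivity), fun m => ?_⟩
  rcases lt_or_ge m M with hm | hm
  · refine ⟨0, le_rfl, le_max_of_le_left ?_⟩
    simp only [ne_eq, OfNat.ofNat_ne_zero, not_false_eq_true, zero_pow, zero_mul, sub_zero,
      Real.exp_zero, mul_one]
    exact_mod_cast hm
  · have hm1 : (1 : ℝ) ≤ m := by exact_mod_cast hM.trans hm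
    have hm0 : (0 : ℝ) < m := by linarith
    have hp : 0 < (m : ℝ) ^ γ := Real.rpow_pos_of_pos hm0 γ
    -- The minimiser of `t ^ 2 * A * m ^ γ - t * ε * m`.
    refine ⟨ε * m / (2 * A * (m : ℝ) ^ γ), by positivity, le_max_of_le_right ?_⟩
    have hexp : (ε * m / (2 * A * (m : ℝ) ^ γ)) ^ 2 * varianceProxy θ m
        - ε * m / (2 * A * (m : ℝ) ^ γ) * (ε * m) ≤ -(ε ^ 2 / (4 * A)) * (m : ℝ) ^ (2 - γ) := by
      have := mul_le_mul_of_nonneg_left (hv m hm)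
        (sq_nonneg (ε * m / (2 * A * (m : ℝ) ^ γ)))
      refine (sub_le_sub_right this _).trans (le_of_eq ?_)
      rw [Real.rpow_sub hm0, Real.rpow_two]
      field_simp
      ring
    have hKm := hK m
    calc _ ≤ (2 * m) * Real.exp (-(ε ^ 2 / (4 * A)) * (m : ℝ) ^ (2 - γ)) :=
          mul_le_mul (by linarith) (Real.exp_le_exp.2 hexp) (Real.exp_nonneg _) (by linarith)
      _ ≤ 2 * K := by linarith

/-! ### Concentration of the step weights -/

section Operator

variable {α : Type*} [Fintype α] [DecidableEq α] [Nonempty α]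

/-- The conditional mean of the new excess is `(1 + θ / length)` times the old one; the fluctuation
is a centred Bernoulli variable. -/
lemma avgStep_exp_excess_le {θ : ℝ} (h0 : 0 ≤ 1 + θ * ((Fintype.card α : ℝ) - 1)) (h1 : θ ≤ 1)
    (t : ℝ) (a : α) (l : List α) :
    avgStep θ (fun l => Real.exp (t * excess l a)) l ≤
      Real.exp (t ^ 2) * Real.exp (t * (1 + θ / l.length) * excess l a) := by
  set q := stepWeight θ l a with hq
  have hsum : ∑ b ∈ Finset.univ.erase a, stepWeight θ l b * Real.exp (t * excess (b :: l) a) =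
      (1 - q) * Real.exp (t * (excess l a - 1 / (Fintype.card α : ℝ))) := by
    have hq1 : 1 - q = ∑ b ∈ Finset.univ.erase a, stepWeight θ l b := by
      rw [hq, sub_eq_iff_eq_add', Finset.add_sum_erase _ _ (Finset.mem_univ a), sum_stepWeight]
    rw [hq1, Finset.sum_mul]
    refine Finset.sum_congr rfl fun b hb => ?_
    rw [excess_cons, if_neg (Finset.ne_of_mem_erase hb), zero_sub, sub_eq_add_neg]
  rw [avgStep, ← Finset.add_sum_erase _ _ (Finset.mem_univ a), hsum, excess_cons, if_pos rfl, ← hq]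
  have hq' : t * (1 + θ / l.length) * excess l a =
      t * (excess l a + (q - 1 / (Fintype.card α : ℝ))) := by
    rw [hq, stepWeight]
    ring
  have e1 : Real.exp (t * (excess l a + (1 - 1 / (Fintype.card α : ℝ)))) =
      Real.exp (t * (1 - q)) * Real.exp (t * (excess l a + (q - 1 / (Fintype.card α : ℝ)))) := by
    rw [← Real.exp_add]
    ring_nf
  have e2 : Real.exp (t * (excess l a - 1 / (Fintype.card α : ℝ))) =
      Real.exp (-(t * q)) * Real.exp (t * (excess l a + (q - 1 / (Fintype.card α : ℝ)))) := by
    rw [← Real.exp_add]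
    ring_nf
  rw [hq', e1, e2, ← mul_assoc, ← mul_assoc, ← add_mul]
  exact mul_le_mul_of_nonneg_right
    (centered_exp_le (stepWeight_nonneg h0 h1 l a) (stepWeight_le_one h0 h1 l a))
    (Real.exp_nonneg _)

lemma expect_exp_excess_le {θ : ℝ} (h0 : 0 ≤ 1 + θ * ((Fintype.card α : ℝ) - 1)) (h1 : θ ≤ 1)
    (a : α) (n : ℕ) (t : ℝ) :
    expect θ n (fun l => Real.exp (t * excess l a)) ≤ Real.exp (t ^ 2 * varianceProxy θ n) := by
  induction n generalizing t with
  | zero => simp [expect, excess_nil, varianceProxy]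
  | succ n ih =>
    rw [expect]
    refine (expect_mono (stepWeight_nonneg h0 h1) (g := fun l => Real.exp (t ^ 2) *
      Real.exp (t * (1 + θ / n) * excess l a)) fun l hl => ?_).trans ?_
    · have := avgStep_exp_excess_le h0 h1 t a l
      rwa [hl] at this
    · rw [expect_const_mul]
      refine (mul_le_mul_of_nonneg_left (ih (t * (1 + θ / n))) (Real.exp_nonneg _)).trans
        (le_of_eq ?_)
      rw [← Real.exp_add, varianceProxy]
      ring_nf

-- A two-sided Chernoff bound with a union over `a`; both tails are needed because `θ` may be
-- negative.
open Classical in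
lemma expect_exists_lt_stepWeight_le {θ : ℝ} (h0 : 0 ≤ 1 + θ * ((Fintype.card α : ℝ) - 1))
    (hm1 : -1 ≤ θ) (h1 : θ ≤ 1) {ε t : ℝ} (hε : 0 < ε) (ht : 0 ≤ t) (n : ℕ) :
    expect θ n (fun l : List α =>
        if ∃ a, 1 / (Fintype.card α : ℝ) + ε < stepWeight θ l a then 1 else 0) ≤
      2 * (Fintype.card α : ℝ) * Real.exp (t ^ 2 * varianceProxy θ n - t * (ε * n)) := by
  have hpt : ∀ l : List α, l.length = n →
      (if ∃ a, 1 / (Fintype.card α : ℝ) + ε < stepWeight θ l a then (1 : ℝ) else 0) ≤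
      ∑ a, Real.exp (-(t * (ε * n))) *
        (Real.exp (t * excess l a) + Real.exp (-t * excess l a)) := by
    intro l hl
    split_ifs with h
    · obtain ⟨a, ha⟩ := h
      refine le_trans ?_ (Finset.single_le_sum (fun b _ => by positivity) (Finset.mem_univ a))
      rw [mul_add, ← Real.exp_add, ← Real.exp_add]
      rw [stepWeight, hl] at ha
      have hε' : ε < |excess l a| / n := by
        have h2 : ε < |θ * (excess l a / n)| := lt_of_lt_of_le (by linarith) (le_abs_self _)
        rw [abs_mul, abs_div, Nat.abs_cast] at h2
        exact h2.trans_le (mul_le_of_le_one_left (by positivity) (abs_le.2 ⟨hm1, h1⟩))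
      have hn : (0 : ℝ) < n := by
        rcases Nat.eq_zero_or_pos n with h | h
        · simp only [h, Nat.cast_zero, div_zero] at hε'
          linarith
        · exact_mod_cast h
      rw [lt_div_iff₀ hn] at hε'
      have h3 := mul_le_mul_of_nonneg_left hε'.le ht
      rcases abs_cases (excess l a) with ⟨h4, _⟩ | ⟨h4, _⟩ <;> rw [h4] at h3
      · have h5 : 1 ≤ Real.exp (-(t * (ε * n)) + t * excess l a) :=
          Real.one_le_exp (by linarith)
        linarith [Real.exp_nonneg (-(t * (ε * n)) + -t * excess l a)]
      · have h5 : 1 ≤ Real.exp (-(t * (ε * n)) + -t * excess l a) :=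
          Real.one_le_exp (by linarith)
        linarith [Real.exp_nonneg (-(t * (ε * n)) + t * excess l a)]
    · positivity
  refine (expect_mono (stepWeight_nonneg h0 h1) hpt).trans ?_
  rw [expect_sum]
  simp only [expect_const_mul, expect_add]
  have hterm : ∀ a : α, Real.exp (-(t * (ε * n))) *
      (expect θ n (fun l => Real.exp (t * excess l a)) +
        expect θ n (fun l => Real.exp (-t * excess l a))) ≤
      2 * Real.exp (t ^ 2 * varianceProxy θ n - t * (ε * n)) := by
    intro a
    have e1 := expect_exp_excess_le h0 h1 a n t
    have e2 := expect_exp_excess_le h0 h1 a n (-t)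
    rw [neg_sq] at e2
    have e3 : Real.exp (t ^ 2 * varianceProxy θ n - t * (ε * n)) =
        Real.exp (-(t * (ε * n))) * Real.exp (t ^ 2 * varianceProxy θ n) := by
      rw [← Real.exp_add]
      ring_nf
    rw [e3]
    have := mul_le_mul_of_nonneg_left (add_le_add e1 e2) (Real.exp_nonneg (-(t * (ε * n))))
    linarith
  refine (Finset.sum_le_sum fun a _ => hterm a).trans (le_of_eq ?_)
  simp only [Finset.sum_const, Finset.card_univ, nsmul_eq_mul]
  ring

/-- If the step weights rarely exceed `5 / 12`, the height is rarely zero. -/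
lemma mul_expect_pow_height_le {θ : ℝ} (h0 : 0 ≤ 1 + θ * ((Fintype.card α : ℝ) - 1))
    (hm1 : -1 ≤ θ) (h1 : θ ≤ 1) (hcard : 3 ≤ Fintype.card α)
    {Δ : List α → ℕ} (hΔ : IsTreeHeight Δ) {K : ℝ}
    (hK : ∀ m : ℕ, ∃ t : ℝ, 0 ≤ t ∧
      ((m : ℝ) + 1) * Real.exp (t ^ 2 * varianceProxy θ m - t * ((1 / 12) * m)) ≤ K) (n : ℕ) :
    (n : ℝ) * expect θ n (fun l => (6 / 7 : ℝ) ^ Δ l) ≤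
      72 * (1 + 2 * (Fintype.card α : ℝ) * K) := by
  classical
  have hw := stepWeight_nonneg (α := α) h0 h1
  have hd : (1 : ℝ) / Fintype.card α ≤ 1 / 3 :=
    one_div_le_one_div_of_le (by norm_num) (by exact_mod_cast hcard)
  have hle1 : ∀ k : ℕ, (6 / 7 : ℝ) ^ k ≤ 1 := fun k => pow_le_one₀ (by norm_num) (by norm_num)
  have hK0 : 0 ≤ K := by
    obtain ⟨t, _, ht⟩ := hK 0
    exact le_trans (by positivity) ht
  induction n with
  | zero =>
    simp only [Nat.cast_zero, zero_mul]
    positivity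
  | succ n ih =>
    set u := expect θ n (fun l => (6 / 7 : ℝ) ^ Δ l) with hu
    have hu1 : u ≤ 1 := by
      refine (expect_mono hw fun l _ => hle1 (Δ l)).trans (le_of_eq ?_)
      exact expect_const θ n 1
    obtain ⟨t, ht, htK⟩ := hK n
    have hbad := expect_exists_lt_stepWeight_le h0 hm1 h1 (ε := 1 / 12) (by norm_num) ht n
    set B := expect θ n (fun l : List α =>
        if ∃ a, 1 / (Fintype.card α : ℝ) + 1 / 12 < stepWeight θ l a then (1 : ℝ) else 0) with hB
    have hstep : expect θ (n + 1) (fun l => (6 / 7 : ℝ) ^ Δ l) ≤ 71 / 72 * u + B := by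
      rw [expect, hu, hB, ← expect_const_mul, ← expect_add]
      refine expect_mono hw fun l _ => ?_
      split_ifs with h
      · have : avgStep θ (fun l => (6 / 7 : ℝ) ^ Δ l) l ≤ 1 := by
          rw [← sum_stepWeight θ l]
          exact Finset.sum_le_sum fun a _ => mul_le_of_le_one_right (hw l a) (hle1 _)
        have h2 : 0 ≤ 71 / 72 * (6 / 7 : ℝ) ^ Δ l := by positivity
        linarith
      · push Not at h
        -- Here `1/d + 1/12 ≤ 5/12`, and `(5/12)/(6/7) + (7/12)(6/7) = 71/72`.
        have := avgStep_pow_height_le hw hΔ (r := 6 / 7) (q := 5 / 12) (by norm_num)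
          (by norm_num) (l := l) (fun a => (h a).trans (by linarith))
        norm_num at this ⊢
        exact this
    have hB' : ((n : ℝ) + 1) * B ≤ 2 * (Fintype.card α : ℝ) * K := by
      calc ((n : ℝ) + 1) * B ≤ ((n : ℝ) + 1) * (2 * (Fintype.card α : ℝ) *
            Real.exp (t ^ 2 * varianceProxy θ n - t * (1 / 12 * n))) := by gcongr
        _ = 2 * (Fintype.card α : ℝ) * (((n : ℝ) + 1) *
            Real.exp (t ^ 2 * varianceProxy θ n - t * (1 / 12 * n))) := by ring
        _ ≤ _ := by gcongr
    -- With `C` the claimed bound, the lost `C / 72 = 1 + 2 d K` pays for `B` and, by `u ≤ 1`, for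
    -- passing from `n` to `n + 1`.
    have h3 := mul_le_mul_of_nonneg_left hstep (by positivity : 0 ≤ (n : ℝ) + 1)
    push_cast
    linarith

end Operator

/-! ### Tree geometry -/

/-- In a tree, two neighbours of `w` that are closer to `v` than `w` coincide. -/
lemma _root_.SimpleGraph.IsTree.eq_of_adj_of_dist_add_one {V : Type*} {G : SimpleGraph V}
    (hG : G.IsTree) {v w x y : V} (hx : G.Adj w x) (hy : G.Adj w y)
    (hxd : G.dist w v = G.dist x v + 1) (hyd : G.dist w v = G.dist y v + 1) : x = y := by
  obtain ⟨p, hp⟩ := hG.connected.exists_walk_length_eq_dist x v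
  obtain ⟨q, hq⟩ := hG.connected.exists_walk_length_eq_dist y v
  have hp' : (SimpleGraph.Walk.cons hx p).IsPath :=
    SimpleGraph.Walk.isPath_of_length_eq_dist _ (by simp [hp, hxd])
  have hq' : (SimpleGraph.Walk.cons hy q).IsPath :=
    SimpleGraph.Walk.isPath_of_length_eq_dist _ (by simp [hq, hyd])
  have h := (hG.existsUnique_path w v).unique hp' hq'
  simpa using congrArg SimpleGraph.Walk.snd h

section Tree

variable {Γ : Type u} [Group Γ] {S : Finset Γ} {d : ℕ}

/-- The distance from the root reached by a history of steps, the latest step coming first. -/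
noncomputable def height (S : Finset Γ) (l : List S) : ℕ :=
  wordDist S (l.map Subtype.val).prod 1

lemma IsTreeGeneratingSet.adj_mul (hS : IsTreeGeneratingSet S d) (a : S) (x : Γ) :
    (cayleyGraph S).Adj x (a * x) := by
  rw [cayleyGraph, SimpleGraph.fromRel_adj]
  refine ⟨fun h => hS.one_notMem ?_, Or.inl ?_⟩
  · have : (a : Γ) = 1 := by simpa using h.symm
    exact this ▸ a.2
  · simp

lemma IsTreeGeneratingSet.isTreeHeight [Nonempty S] (hS : IsTreeGeneratingSet S d) :
    IsTreeHeight (height S) := by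
  intro l
  have hrec : ∀ a : S, height S (a :: l) = wordDist S (a * (l.map Subtype.val).prod) 1 := by
    intro a
    rw [height, List.map_cons, List.prod_cons]
  have hstep : ∀ a : S, height S l = height S (a :: l) + 1 ∨
      height S (a :: l) = height S l + 1 := by
    intro a
    rw [hrec, height, wordDist, wordDist, SimpleGraph.dist_comm, SimpleGraph.dist_comm (v := 1)]
    exact hS.isTree.dist_eq_dist_add_one_of_adj 1 (hS.adj_mul a _)
  by_cases h : ∃ b : S, height S l = height S (b :: l) + 1
  · obtain ⟨b, hb⟩ := h
    refine ⟨b, fun a hab => (hstep a).resolve_left fun ha => hab ?_, hb.le⟩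
    rw [hrec] at ha hb
    exact Subtype.ext (mul_right_cancel
      (hS.isTree.eq_of_adj_of_dist_add_one (hS.adj_mul a _) (hS.adj_mul b _) ha hb))
  · push Not at h
    have h' : ∀ a : S, height S (a :: l) = height S l + 1 := fun a =>
      (hstep a).resolve_left (h a)
    -- No neighbour is closer, as at the root: any step may play the exceptional one.
    exact ⟨Classical.arbitrary S, fun a _ => h' a, by rw [h']; omega⟩

end Tree

/-! ### From the elephant walk to the operator -/

section Law

/-- The history `[s (n - 1), …, s 0]`. -/
def histOf {α : Type*} : {n : ℕ} → (Fin n → α) → List α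
  | 0, _ => []
  | _ + 1, s => s (Fin.last _) :: histOf (Fin.init s)

lemma length_histOf {α : Type*} {n : ℕ} (s : Fin n → α) : (histOf s).length = n := by
  induction n with
  | zero => rfl
  | succ n ih => simp [histOf, ih]

variable {Γ : Type u} {S : Finset Γ}

/-- The reinforcement parameter of the elephant random walk. -/
noncomputable def reinforcement (p : ℝ) (d : ℕ) : ℝ := (p * d - 1) / ((d : ℝ) - 1)

lemma height_histOf [Group Γ] {n : ℕ} (x : ℕ → S) :
    height S (histOf fun i : Fin n => x i) = wordDist S (position x n) 1 := by
  have : ∀ m : ℕ, ((histOf fun i : Fin m => x i).map Subtype.val).prod = position x m := by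
    intro m
    induction m with
    | zero => rfl
    | succ m ih =>
      rw [histOf, List.map_cons, List.prod_cons, position, ← ih]
      rfl
  rw [height, this]

open Classical in
lemma sum_stepProb (hcard : 2 ≤ S.card) (p : ℝ) {n : ℕ} (s : Fin n → S) (a : S) :
    ∑ j, stepProb S p (s j) a =
      n / (S.card : ℝ) + reinforcement p S.card * excess (histOf s) a := by
  have hd : (1 : ℝ) < S.card := by exact_mod_cast hcard
  have hd1 : (S.card : ℝ) - 1 ≠ 0 := by linarith
  have hd0 : (S.card : ℝ) ≠ 0 := by linarith
  induction n with
  | zero => simp [histOf, excess_nil]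
  | succ n ih =>
    have ih' := ih (Fin.init s)
    simp only [Fin.init] at ih'
    rw [Fin.sum_univ_castSucc, ih', histOf, excess_cons, stepProb, reinforcement,
      Fintype.card_coe]
    by_cases h : s (Fin.last n) = a
    · rw [if_pos h, if_pos h.symm]
      push_cast
      field_simp
      ring
    · rw [if_neg h, if_neg (Ne.symm h)]
      push_cast
      field_simp
      ring

variable {Ω : Type v} [MeasurableSpace Ω] {P : Measure Ω} [IsProbabilityMeasure P]
  {p : ℝ} {g : ℕ → Ω → S} {D : (n : ℕ) → Ω → Fin (n + 1)}

open Classical in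
lemma IsElephantSteps.measureReal_snoc_le (hg : IsElephantSteps P S p g D) (hcard : 2 ≤ S.card)
    {n : ℕ} (s : Fin n → S) (a : S) :
    P.real {ω | (∀ i : Fin n, g i ω = s i) ∧ g n ω = a} ≤
      P.real {ω | ∀ i : Fin n, g i ω = s i} *
        stepWeight (reinforcement p S.card) (histOf s) a := by
  cases n with
  -- On the empty history the excess vanishes, so the weight is the uniform `1/d`.
  | zero => simp [histOf, stepWeight, excess_nil, hg.first_step]
  | succ n =>
    -- A union bound over the recalled index; an upper bound on the law is all that is needed.
    have hsub : {ω | (∀ i : Fin (n + 1), g i ω = s i) ∧ g (n + 1) ω = a} ⊆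
        ⋃ j : Fin (n + 1),
          {ω | (∀ i : Fin (n + 1), g i ω = s i) ∧ D n ω = j ∧ g (n + 1) ω = a} := by
      intro ω hω
      exact Set.mem_iUnion.2 ⟨D n ω, hω.1, rfl, hω.2⟩
    refine (measureReal_mono hsub).trans ((measureReal_iUnion_fintype_le _).trans (le_of_eq ?_))
    have hn : (n : ℝ) + 1 ≠ 0 := by positivity
    simp only [hg.next_step]
    rw [← Finset.mul_sum, sum_stepProb hcard, mul_assoc, stepWeight, length_histOf,
      Fintype.card_coe]
    push_cast
    field_simp

open Classical in
lemma IsElephantSteps.sum_measureReal_le_expect (hg : IsElephantSteps P S p g D)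
    (hcard : 2 ≤ S.card) (n : ℕ) {f : List S → ℝ}
    (hw : ∀ (l : List S) a, 0 ≤ stepWeight (reinforcement p S.card) l a) (hf : ∀ l, 0 ≤ f l) :
    ∑ s : Fin n → S, P.real {ω | ∀ i : Fin n, g i ω = s i} * f (histOf s) ≤
      expect (reinforcement p S.card) n f := by
  induction n generalizing f with
  | zero => simp [expect, histOf]
  | succ n ih =>
    rw [expect]
    refine le_trans ?_ (ih fun l => Finset.sum_nonneg fun a _ => mul_nonneg (hw l a) (hf _))
    rw [← Equiv.sum_comp (Fin.snocEquiv fun _ => S), Fintype.sum_prod_type_right]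
    refine Finset.sum_le_sum fun s _ => ?_
    rw [avgStep, Finset.mul_sum]
    refine Finset.sum_le_sum fun a _ => ?_
    have hhist : histOf (Fin.snocEquiv (fun _ => S) (a, s)) = a :: histOf s := by
      simp [histOf, Fin.snocEquiv]
    have hset : {ω | ∀ i : Fin (n + 1), g i ω = Fin.snocEquiv (fun _ => S) (a, s) i} =
        {ω | (∀ i : Fin n, g i ω = s i) ∧ g n ω = a} := by
      ext ω
      simp [Fin.snocEquiv, Fin.forall_fin_succ']
    rw [hhist, hset, ← mul_assoc]
    exact mul_le_mul_of_nonneg_right (hg.measureReal_snoc_le hcard s a) (hf _)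

open Classical in
lemma IsElephantSteps.measureReal_distRoot_eq_zero_le [Group Γ] (hg : IsElephantSteps P S p g D)
    (hcard : 2 ≤ S.card) (n : ℕ) {r : ℝ} (hr : 0 ≤ r)
    (hw : ∀ (l : List S) a, 0 ≤ stepWeight (reinforcement p S.card) l a) :
    P.real {ω | distRoot g n ω = 0} ≤
      expect (reinforcement p S.card) n (fun l => r ^ height S l) := by
  refine le_trans ?_ (hg.sum_measureReal_le_expect hcard n hw fun l => pow_nonneg hr _)
  have hsub : {ω | distRoot g n ω = 0} ⊆
      ⋃ s ∈ (Finset.univ.filter fun s : Fin n → S => height S (histOf s) = 0),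
        {ω | ∀ i : Fin n, g i ω = s i} := by
    intro ω hω
    simp only [Set.mem_iUnion]
    refine ⟨fun i => g i ω, ?_, fun i => rfl⟩
    simpa [height_histOf fun k => g k ω, distRoot] using hω
  refine (measureReal_mono hsub (measure_ne_top P _)).trans ((measureReal_biUnion_finset_le _ _).trans ?_)
  rw [Finset.sum_filter]
  refine Finset.sum_le_sum fun s _ => ?_
  split_ifs with h
  · simp [h]
  · positivity

end Law

/-! ### Parameter bounds and the contraction rate -/

lemma reinforcement_bounds {p : ℝ} {d : ℕ} (hd : 3 ≤ d) (h0 : 0 ≤ p) (h1 : p ≤ 1) :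
    0 ≤ 1 + reinforcement p d * ((d : ℝ) - 1) ∧ -1 ≤ reinforcement p d ∧
      reinforcement p d ≤ 1 := by
  have hd' : (3 : ℝ) ≤ d := by exact_mod_cast hd
  have hd1 : 0 < (d : ℝ) - 1 := by linarith
  have hpd : 0 ≤ p * d := by positivity
  refine ⟨?_, ?_, ?_⟩
  · rw [reinforcement, div_mul_cancel₀ _ hd1.ne']
    linarith
  · rw [reinforcement, le_div_iff₀ hd1]
    linarith
  · rw [reinforcement, div_le_one hd1]
    nlinarith

lemma reinforcement_lt_one {p : ℝ} {d : ℕ} (hd : 3 ≤ d) (h1 : p < 1) :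
    reinforcement p d < 1 := by
  have hd' : (3 : ℝ) ≤ d := by exact_mod_cast hd
  rw [reinforcement, div_lt_one (by linarith)]
  nlinarith

/-- The weight is affine in the frequency of `a`, so its extremes are `(1 - p)/(d - 1)` (never used,
`θ ≤ 0`) and `p` (always used, `θ ≥ 0`). -/
lemma stepWeight_le_alpha {α : Type*} [Fintype α] [DecidableEq α] [Nonempty α] {p : ℝ}
    (hd : 3 ≤ Fintype.card α) (l : List α) (a : α) :
    stepWeight (reinforcement p (Fintype.card α)) l a ≤ (1 - alpha p (Fintype.card α)) / 2 := by
  have hd' : (3 : ℝ) ≤ Fintype.card α := by exact_mod_cast hd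
  have hd1 : 0 < (Fintype.card α : ℝ) - 1 := by linarith
  have hd0 : 0 < (Fintype.card α : ℝ) := by linarith
  rw [stepWeight, alpha]
  split_ifs with h
  · have hθ : reinforcement p (Fintype.card α) ≤ 0 := by
      rw [le_div_iff₀ hd0] at h
      exact div_nonpos_of_nonpos_of_nonneg (by linarith) hd1.le
    refine (add_le_add_right (mul_le_mul_of_nonpos_left (le_excess_div_length l a) hθ) _).trans
      (le_of_eq ?_)
    rw [reinforcement]
    field_simp
    ring
  · have hθ : 0 ≤ reinforcement p (Fintype.card α) := by
      rw [not_le, div_lt_iff₀ hd0] at h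
      exact div_nonneg (by linarith) hd1.le
    refine (add_le_add_right (mul_le_mul_of_nonneg_left (excess_div_length_le l a) hθ) _).trans
      (le_of_eq ?_)
    rw [reinforcement]
    field_simp
    ring

lemma alpha_mem_Ioc {p : ℝ} {d : ℕ} (hd : 3 ≤ d) (h0 : 0 ≤ p) (h1 : p < 1 / 2)
    (hne : (p, d) ≠ ((0 : ℝ), 3)) : 0 < alpha p d ∧ alpha p d ≤ 1 := by
  have hd' : (3 : ℝ) ≤ d := by exact_mod_cast hd
  have hd1 : 0 < (d : ℝ) - 1 := by linarith
  rw [alpha]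
  split_ifs with h
  · constructor
    · rw [sub_pos, div_lt_one hd1]
      rcases h0.eq_or_lt with h2 | h2
      · have : d ≠ 3 := fun h3 => hne (by rw [← h2, h3])
        have : (4 : ℝ) ≤ d := by exact_mod_cast (by omega : 4 ≤ d)
        linarith
      · linarith
    · have : 0 ≤ 2 * (1 - p) / ((d : ℝ) - 1) := div_nonneg (by linarith) hd1.le
      linarith
  · constructor <;> linarith

/-- With `q = (1 - x)/2` and `r = 1 - x/2`, clearing denominators in `rate ≤ 1 - x ^ 2 / 8` leaves
`x ^ 2 * (4 - x) ≥ 0`. -/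
lemma contraction_rate_le {x : ℝ} (h1 : x ≤ 1) :
    (1 - x) / 2 / (1 - x / 2) + (1 - (1 - x) / 2) * (1 - x / 2) ≤ Real.exp (-(x ^ 2 / 8)) := by
  have hr : 0 < 1 - x / 2 := by linarith
  have : (1 - x) / 2 / (1 - x / 2) + (1 - (1 - x) / 2) * (1 - x / 2) ≤ 1 - x ^ 2 / 8 := by
    rw [← le_sub_iff_add_le, div_le_iff₀ hr]
    nlinarith [mul_nonneg (sq_nonneg x) (by linarith : 0 ≤ 4 - x)]
  linarith [Real.add_one_le_exp (-(x ^ 2 / 8))]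

end ElephantWalk

/-! ### The theorem -/

theorem theorem3 (d : ℕ) (hd : 3 ≤ d) (p : ℝ) :
    (0 ≤ p → p < 1 / 2 → (p, d) ≠ ((0 : ℝ), 3) →
      ∀ (Γ : Type u) [Group Γ] (S : Finset Γ) (_ : ElephantWalk.IsTreeGeneratingSet S d)
        (Ω : Type v) [MeasurableSpace Ω] (P : Measure Ω) [IsProbabilityMeasure P]
        (g : ℕ → Ω → S) (D : (n : ℕ) → Ω → Fin (n + 1))
        (_ : ElephantWalk.IsElephantSteps P S p g D) (n : ℕ),
        P.real {ω | ElephantWalk.distRoot g n ω = 0} ≤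
          Real.exp (-((n : ℝ) * ElephantWalk.alpha p d ^ 2 / 8))) ∧
    ((1 / 2 ≤ p ∧ p < 1) ∨ (p, d) = ((0 : ℝ), 3) →
      ∃ C : ℝ, 0 < C ∧
        ∀ (Γ : Type u) [Group Γ] (S : Finset Γ) (_ : ElephantWalk.IsTreeGeneratingSet S d)
          (Ω : Type v) [MeasurableSpace Ω] (P : Measure Ω) [IsProbabilityMeasure P]
          (g : ℕ → Ω → S) (D : (n : ℕ) → Ω → Fin (n + 1))
          (_ : ElephantWalk.IsElephantSteps P S p g D) (n : ℕ), 1 ≤ n →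
          P.real {ω | ElephantWalk.distRoot g n ω = 0} ≤ C * (n : ℝ)⁻¹) := by
  classical
  open ElephantWalk in
  constructor
  · intro h0 h1 hne Γ _ S hS Ω _ P _ g D hg n
    obtain ⟨hα0, hα1⟩ := alpha_mem_Ioc hd h0 h1 hne
    have hcard := hS.card_eq
    subst hcard
    have : Nonempty S := (Finset.card_pos.1 (by omega : 0 < S.card)).to_subtype
    obtain ⟨hθ0, -, hθ1⟩ := reinforcement_bounds hd h0 (by linarith : p ≤ 1)
    have hw : ∀ (l : List S) a, 0 ≤ stepWeight (reinforcement p S.card) l a :=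
      stepWeight_nonneg (by simpa using hθ0) hθ1
    have hq : ∀ (l : List S) a,
        stepWeight (reinforcement p S.card) l a ≤ (1 - alpha p S.card) / 2 := by
      intro l a
      have := stepWeight_le_alpha (p := p) (by simpa using hd) l a
      simpa only [Fintype.card_coe] using this
    set x := alpha p S.card
    have hr : 0 < 1 - x / 2 := by linarith
    have hκ : 0 ≤ (1 - x) / 2 / (1 - x / 2) + (1 - (1 - x) / 2) * (1 - x / 2) :=
      add_nonneg (div_nonneg (by linarith) hr.le) (mul_nonneg (by linarith) hr.le)
    calc P.real {ω | distRoot g n ω = 0}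
        ≤ expect (reinforcement p S.card) n (fun l => (1 - x / 2) ^ height S l) :=
          hg.measureReal_distRoot_eq_zero_le (by omega) n hr.le hw
      _ ≤ ((1 - x) / 2 / (1 - x / 2) + (1 - (1 - x) / 2) * (1 - x / 2)) ^ n :=
          expect_pow_height_le hw hS.isTreeHeight hr (by linarith) hκ hq n
      _ ≤ Real.exp (-(x ^ 2 / 8)) ^ n := pow_le_pow_left₀ hκ (contraction_rate_le hα1) n
      _ = Real.exp (-((n : ℝ) * x ^ 2 / 8)) := by
          rw [← Real.exp_nat_mul]
          ring_nf
  · intro h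
    have hp : 0 ≤ p ∧ p < 1 := by
      rcases h with ⟨h0, h1⟩ | h
      · exact ⟨by linarith, h1⟩
      · rw [(Prod.mk.inj h).1]
        norm_num
    obtain ⟨hθ0, hθm, hθ1⟩ := reinforcement_bounds hd hp.1 hp.2.le
    -- `K` is fixed before the group and the walk, so the constant depends only on `p` and `d`.
    obtain ⟨K, hK0, hK⟩ := exists_deviation_bound hθm (reinforcement_lt_one hd hp.2)
      (by norm_num : (0 : ℝ) < 1 / 12)
    refine ⟨72 * (1 + 2 * (d : ℝ) * K), by positivity, ?_⟩
    intro Γ _ S hS Ω _ P _ g D hg n hn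
    have hcard := hS.card_eq
    subst hcard
    have : Nonempty S := (Finset.card_pos.1 (by omega : 0 < S.card)).to_subtype
    have hw : ∀ (l : List S) a, 0 ≤ stepWeight (reinforcement p S.card) l a :=
      stepWeight_nonneg (by simpa using hθ0) hθ1
    have h1 := hg.measureReal_distRoot_eq_zero_le (by omega) n (by norm_num : (0 : ℝ) ≤ 6 / 7) hw
    have h2 := mul_expect_pow_height_le (by simpa using hθ0) hθm hθ1 (by simpa using hd)
      hS.isTreeHeight hK n
    rw [Fintype.card_coe] at h2
    have hn' : (0 : ℝ) < n := by exact_mod_cast hn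
    rw [← div_eq_mul_inv, le_div_iff₀ hn', mul_comm]
    exact (mul_le_mul_of_nonneg_left h1 hn'.le).trans h2
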